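/- Let $s\in\mathbb{R}$, $s\ge\tfrac12$. With $\hat u(\xi)=\frac{1}{\sqrt{2\pi}}\int_{\mathbb R}u(x)e^{-ix\xi}\,dx$ (extended to $L^2$), let $H^s=H^s(\mathbb{R};\mathbb{C})$ be the Hilbert space of those $u\in L^2(\mathbb{R};\mathbb{C})$ with $\|u\|_{H^s}^2=\int_{\mathbb R}(1+|\xi|^{2s})|\hat u(\xi)|^2\,d\xi<\infty$, and let $D^s:H^s\to L^2$ be the operator given by $\widehat{D^su}(\xi)=|\xi|^s\hat u(\xi)$. Let $W:[0,\infty)\to\mathbb{R}$ be of class $C^2$ (one-sided derivatives at $0$) with $W(0)=W'(0)=0$ and $E_0:=\tfrac12W''(0)>0$. Put $N(r)=W(r)-E_0r^2$ and assume: 1. there is $r_0>0$ with $N(r_0)<0$; 2. there are $2<q_1\le q_2<\infty$ and a constant $c_1$ such that $|N'(r)|\le c_1(r^{q_1-1}+r^{q_2-1})$ for all $r\ge0$; 3. there are $p\in(2,4s+2)$ and $c\ge0$ such that $N(r)\ge-c\,r^p$ for all sufficiently large $r$. For $\psi\in H^s$ let $$E(\psi)=\int_{\mathbb R}\Big(\tfrac12|D^s\psi|^2+W(|\psi|)\Big)dx,\qquad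 C(\psi)=\int_{\mathbb R}|\psi|^2\,dx,$$ and for $\psi\ne0$ let $\Lambda(\psi)=E(\psi)/|C(\psi)|$. A sequence $(\psi_n)$ in $H^s$ is called vanishing if for every sequence $(x_n)$ of real numbers the translates $\psi_n(\cdot-x_n)$ converge weakly to $0$ in $H^s$. Let $$\Lambda_0=\inf\Big\{\liminf_{n\to\infty}\Lambda(\psi_n)\ :\ (\psi_n)\text{ is a vanishing sequence of nonzero elements of }H^s\Big\}\in[-\infty,+\infty].$$ Then the energy is well defined, that is, $\tfrac12|D^s\psi|^2+W(|\psi|)$ is integrable for every $\psi\in H^s$, and the hylomorphy condition holds: $$\inf_{\psi\in H^s,\ \psi\neq0}\Lambda(\psi)<\Lambda_0,$$ where the infimum on the left is taken in $[-\infty,+\infty)$. -/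

import Mathlib

open MeasureTheory Filter Topology

noncomputable section

namespace Hylomorphy

/-! ### The space `H^s(ℝ; ℂ)` and the operator `D^s` -/

/-- Complex-valued `L²` functions on the line. -/
abbrev L2 : Type := Lp (α := ℝ) ℂ 2 (volume : Measure ℝ)

/-- The Fourier transform on `L²`, in Mathlib's normalization
`û(ξ) = ∫ u(x) e^{-2πi x ξ} dx`. -/
abbrev fourierL2 : L2 ≃ₗᵢ[ℂ] L2 := Lp.fourierTransformₗᵢ ℝ ℂ

/-- The symbol of `D^s`. In the normalization `(2π)^{-1/2} ∫ u(x) e^{-i x η} dx` of the Fourier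
transform the symbol is `|η|^s`; Mathlib's frequency is `ξ = η / (2π)`. -/
def symbol (s ξ : ℝ) : ℝ := |2 * Real.pi * ξ| ^ s

lemma measurable_symbol (s : ℝ) : Measurable (symbol s) := by
  unfold symbol
  fun_prop

/-- `H^s` as a linear subspace of `L²`: those `u` for which `|η|^s û(η)` is square integrable. -/
def sobolevSubmodule (s : ℝ) : Submodule ℂ L2 where
  carrier := {u | MemLp (fun ξ => (symbol s ξ : ℂ) * fourierL2 u ξ) 2 volume}
  zero_mem' := by
    refine (MemLp.zero' (p := 2) (μ := volume) (α := ℝ) (ε := ℂ)).ae_eq ?_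
    have h : fourierL2 (0 : L2) = 0 := map_zero _
    rw [h]
    filter_upwards [Lp.coeFn_zero ℂ 2 (volume : Measure ℝ)] with ξ hξ
    rw [hξ]
    simp
  add_mem' := by
    intro u v hu hv
    refine (MemLp.add hu hv).ae_eq ?_
    rw [map_add]
    filter_upwards [Lp.coeFn_add (fourierL2 u) (fourierL2 v)] with ξ hξ
    rw [hξ]
    simp [mul_add]
  smul_mem' := by
    intro c u hu
    refine (MemLp.const_smul hu c).ae_eq ?_
    rw [map_smul]
    filter_upwards [Lp.coeFn_smul c (fourierL2 u)] with ξ hξ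
    rw [hξ]
    simp [mul_left_comm]

/-- The Sobolev space `H^s = H^s(ℝ; ℂ)`. It is a separate type because its norm is not the one
of `L²`. -/
def Hs (s : ℝ) : Type := sobolevSubmodule s

instance (s : ℝ) : AddCommGroup (Hs s) := inferInstanceAs (AddCommGroup (sobolevSubmodule s))

instance (s : ℝ) : Module ℂ (Hs s) := inferInstanceAs (Module ℂ (sobolevSubmodule s))

/-- The inclusion `H^s ⊂ L²`. -/
def toL2 (s : ℝ) : Hs s →ₗ[ℂ] L2 := (sobolevSubmodule s).subtype

lemma toL2_injective (s : ℝ) : Function.Injective (toL2 s) := Subtype.val_injective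

lemma memLp_symbol_mul (s : ℝ) (u : Hs s) :
    MemLp (fun ξ => (symbol s ξ : ℂ) * fourierL2 (toL2 s u) ξ) 2 volume := u.2

/-- The operator `D^s : H^s → L²`, the Fourier multiplier with symbol `|η|^s`. -/
def fracD (s : ℝ) : Hs s →ₗ[ℂ] L2 where
  toFun u := fourierL2.symm ((memLp_symbol_mul s u).toLp _)
  map_add' := by
    intro u v
    rw [← map_add, ← MemLp.toLp_add]
    congr 1
    rw [MemLp.toLp_eq_toLp_iff]
    rw [map_add, map_add]
    filter_upwards [Lp.coeFn_add (fourierL2 (toL2 s u)) (fourierL2 (toL2 s v))] with ξ hξ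
    rw [hξ]
    simp [mul_add]
  map_smul' := by
    intro c u
    rw [RingHom.id_apply, ← map_smul, ← MemLp.toLp_const_smul]
    congr 1
    rw [MemLp.toLp_eq_toLp_iff]
    rw [map_smul, map_smul]
    filter_upwards [Lp.coeFn_smul c (fourierL2 (toL2 s u))] with ξ hξ
    rw [hξ]
    simp [mul_left_comm]

/-- The inner product `⟪u, v⟫ + ⟪D^s u, D^s v⟫` (inner products of `L²`) on `H^s`; by Plancherel
its norm is the norm `(∫ (1 + |η|^{2s}) |û(η)|² dη)^{1/2}`. -/
@[reducible] def hsCore (s : ℝ) : InnerProductSpace.Core ℂ (Hs s) where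
  inner u v := inner ℂ (toL2 s u) (toL2 s v) + inner ℂ (fracD s u) (fracD s v)
  conj_inner_symm u v := by simp
  re_inner_nonneg u := by
    rw [map_add]
    exact add_nonneg inner_self_nonneg inner_self_nonneg
  add_left u v w := by
    simp only [map_add, inner_add_left]
    ring
  smul_left u v c := by
    simp only [map_smul, inner_smul_left]
    ring
  definite u h := by
    have h1 : RCLike.re (inner ℂ (toL2 s u) (toL2 s u))
        + RCLike.re (inner ℂ (fracD s u) (fracD s u)) = 0 := by
      rw [← map_add, h, map_zero]
    have h2 : 0 ≤ RCLike.re (inner ℂ (toL2 s u) (toL2 s u)) := inner_self_nonneg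
    have h3 : 0 ≤ RCLike.re (inner ℂ (fracD s u) (fracD s u)) := inner_self_nonneg
    have h4 : RCLike.re (inner ℂ (toL2 s u) (toL2 s u)) = 0 := by linarith
    rw [inner_self_eq_norm_sq] at h4
    have h5 : toL2 s u = 0 := by simpa using h4
    exact toL2_injective s (by rw [h5, map_zero])

instance (s : ℝ) : NormedAddCommGroup (Hs s) := (hsCore s).toNormedAddCommGroup

instance (s : ℝ) : InnerProductSpace ℂ (Hs s) :=
  InnerProductSpace.ofCore (hsCore s).toCore

lemma inner_eq (s : ℝ) (u v : Hs s) :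
    inner ℂ u v = inner ℂ (toL2 s u) (toL2 s v) + inner ℂ (fracD s u) (fracD s v) := rfl

lemma norm_sq_eq (s : ℝ) (u : Hs s) : ‖u‖ ^ 2 = ‖toL2 s u‖ ^ 2 + ‖fracD s u‖ ^ 2 := by
  have h : RCLike.re (inner ℂ u u) = RCLike.re (inner ℂ (toL2 s u) (toL2 s u))
      + RCLike.re (inner ℂ (fracD s u) (fracD s u)) := by rw [inner_eq, map_add]
  simpa only [inner_self_eq_norm_sq] using h

/-! ### Translations -/

/-- The translate `u(· - a)` of `u ∈ L²`. -/
def translateL2 (a : ℝ) : L2 →ₗᵢ[ℂ] L2 :=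
  Lp.compMeasurePreservingₗᵢ ℂ (fun x => x - a) (measurePreserving_sub_right volume a)

lemma coeFn_translateL2 (a : ℝ) (u : L2) : translateL2 a u =ᵐ[volume] fun x => u (x - a) :=
  Lp.coeFn_compMeasurePreserving u (measurePreserving_sub_right volume a)

lemma memLp_phase (a : ℝ) (u : L2) :
    MemLp (fun ξ => Real.fourierChar (-(a * ξ)) • u ξ) 2 volume := by
  refine (Lp.memLp u).congr_norm ?_ ?_
  · refine AEStronglyMeasurable.smul ?_ (Lp.aestronglyMeasurable u)
    have h : Continuous fun ξ : ℝ => -(a * ξ) := by fun_prop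
    exact (continuous_subtype_val.comp (Real.continuous_fourierChar.comp h)).aestronglyMeasurable
  · exact Eventually.of_forall fun ξ => (Circle.norm_smul _ _).symm

/-- Multiplication by the phase `e^{-2πi a ξ}` on `L²`. -/
def phaseL2 (a : ℝ) : L2 →ₗᵢ[ℂ] L2 where
  toFun u := (memLp_phase a u).toLp _
  map_add' := by
    intro u v
    rw [← MemLp.toLp_add, MemLp.toLp_eq_toLp_iff]
    filter_upwards [Lp.coeFn_add u v] with ξ hξ
    rw [hξ]
    simp
  map_smul' := by
    intro c u
    rw [RingHom.id_apply, ← MemLp.toLp_const_smul, MemLp.toLp_eq_toLp_iff]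
    filter_upwards [Lp.coeFn_smul c u] with ξ hξ
    rw [hξ]
    simp [Circle.smul_def, mul_left_comm]
  norm_map' u := by
    change ‖(memLp_phase a u).toLp _‖ = ‖u‖
    rw [Lp.norm_toLp, Lp.norm_def]
    congr 1
    exact eLpNorm_congr_norm_ae (Eventually.of_forall fun ξ => Circle.norm_smul _ _)

/-- The Fourier transform turns translations into multiplication by phases. -/
lemma fourierL2_translateL2 (a : ℝ) (u : L2) :
    fourierL2 (translateL2 a u) = phaseL2 a (fourierL2 u) := by
  refine DenseRange.induction_on
    (p := fun u : L2 => fourierL2 (translateL2 a u) = phaseL2 a (fourierL2 u))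
    (SchwartzMap.denseRange_toLpCLM (p := 2) (E := ℝ) (F := ℂ) (μ := volume) ENNReal.ofNat_ne_top)
    u ?_ ?_
  · exact isClosed_eq (fourierL2.continuous.comp (translateL2 a).continuous)
      ((phaseL2 a).continuous.comp fourierL2.continuous)
  · intro f
    have hT : translateL2 a (f.toLp 2 volume) = (f.compSubConstCLM ℂ a).toLp 2 volume := by
      apply Lp.ext
      have h := (measurePreserving_sub_right (volume : Measure ℝ) a).quasiMeasurePreserving.ae_eq
        (f.coeFn_toLp 2 volume)
      filter_upwards [coeFn_translateL2 a (f.toLp 2 volume), h,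
        (f.compSubConstCLM ℂ a).coeFn_toLp 2 volume] with x h1 h2 h3
      rw [h1, h3]
      exact h2
    have hF : ∀ g : SchwartzMap ℝ ℂ, fourierL2 (g.toLp 2 volume)
        = (FourierTransform.fourier g).toLp 2 volume := fun g => SchwartzMap.toLp_fourier_eq g
    change fourierL2 (translateL2 a (f.toLp 2 volume)) = phaseL2 a (fourierL2 (f.toLp 2 volume))
    rw [hT, hF, hF]
    apply Lp.ext
    filter_upwards [(FourierTransform.fourier (f.compSubConstCLM ℂ a)).coeFn_toLp 2 volume,
      (FourierTransform.fourier f).coeFn_toLp 2 volume,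
      (memLp_phase a ((FourierTransform.fourier f).toLp 2 volume)).coeFn_toLp] with ξ h1 h2 h3
    refine h1.trans (Eq.trans ?_ h3.symm)
    rw [h2, SchwartzMap.fourier_coe, SchwartzMap.fourier_coe]
    have h := congrFun (VectorFourier.fourierIntegral_comp_add_right Real.fourierChar volume
      (innerₗ ℝ) (f : ℝ → ℂ) (-a)) ξ
    rw [mul_comm a ξ]
    simp only [innerₗ_apply_apply, RCLike.inner_apply, conj_trivial, mul_neg] at h
    exact h

lemma norm_fourier_translateL2 (a : ℝ) (u : L2) :
    (fun ξ => ‖fourierL2 (translateL2 a u) ξ‖) =ᵐ[volume] fun ξ => ‖fourierL2 u ξ‖ := by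
  rw [fourierL2_translateL2]
  filter_upwards [(memLp_phase a (fourierL2 u)).coeFn_toLp] with ξ hξ
  refine (congrArg norm hξ).trans ?_
  exact Circle.norm_smul _ _

lemma translateL2_mem (s a : ℝ) (u : Hs s) : translateL2 a (toL2 s u) ∈ sobolevSubmodule s := by
  refine (memLp_symbol_mul s u).congr_norm ?_ ?_
  · exact ((Complex.measurable_ofReal.comp (measurable_symbol s)).aestronglyMeasurable).mul
      (Lp.aestronglyMeasurable _)
  · filter_upwards [norm_fourier_translateL2 a (toL2 s u)] with ξ hξ
    simp only [norm_mul, hξ]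

/-- The translate `u(· - a)` of `u ∈ H^s`. -/
def translate (s a : ℝ) (u : Hs s) : Hs s := ⟨translateL2 a (toL2 s u), translateL2_mem s a u⟩

lemma coeFn_translate (s a : ℝ) (u : Hs s) :
    toL2 s (translate s a u) =ᵐ[volume] fun x => toL2 s u (x - a) :=
  coeFn_translateL2 a (toL2 s u)

/-! ### Energy, charge, hylenic ratio -/

/-- `E₀ = W''(0) / 2`, for a function `W` on `[0, ∞)`. -/
def E₀ (W : ℝ → ℝ) : ℝ := iteratedDerivWithin 2 W (Set.Ici 0) 0 / 2

/-- The nonlinear part `N(r) = W(r) - E₀ r²`. -/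
def N (W : ℝ → ℝ) (r : ℝ) : ℝ := W r - E₀ W * r ^ 2

/-- The energy density `|D^s ψ|² / 2 + W(|ψ|)`. -/
def energyDensity (s : ℝ) (W : ℝ → ℝ) (ψ : Hs s) (x : ℝ) : ℝ :=
  1 / 2 * ‖fracD s ψ x‖ ^ 2 + W ‖toL2 s ψ x‖

/-- The energy `E`. -/
def energy (s : ℝ) (W : ℝ → ℝ) (ψ : Hs s) : ℝ := ∫ x, energyDensity s W ψ x

/-- The hylenic charge `C`. -/
def charge (s : ℝ) (ψ : Hs s) : ℝ := ∫ x, ‖toL2 s ψ x‖ ^ 2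

/-- The hylenic ratio `Λ = E / |C|`, meaningful for `ψ ≠ 0`. -/
def hylenicRatio (s : ℝ) (W : ℝ → ℝ) (ψ : Hs s) : ℝ := energy s W ψ / |charge s ψ|

/-! ### Vanishing sequences and `Λ₀` -/

/-- Weak convergence in `H^s`. -/
def WeakTendsto (s : ℝ) (u : ℕ → Hs s) (v : Hs s) : Prop :=
  ∀ ℓ : Hs s →L[ℂ] ℂ, Tendsto (fun n => ℓ (u n)) atTop (𝓝 (ℓ v))

/-- A sequence is vanishing if all its sequences of translates converge weakly to `0`. -/
def IsVanishing (s : ℝ) (u : ℕ → Hs s) : Prop :=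
  ∀ a : ℕ → ℝ, WeakTendsto s (fun n => translate s (a n) (u n)) 0

/-- `Λ₀ = inf {liminf Λ(u_n) | u_n vanishing}`. The terms of the sequences are nonzero, so that
`Λ(u_n)` makes sense; the lower limit and the infimum are taken in `[-∞, ∞]`. -/
def Λ₀ (s : ℝ) (W : ℝ → ℝ) : EReal :=
  sInf {l | ∃ u : ℕ → Hs s, (∀ n, u n ≠ 0) ∧ IsVanishing s u ∧
    l = liminf (fun n => (hylenicRatio s W (u n) : EReal)) atTop}

end Hylomorphy

end

namespace Hylomorphy

open scoped FourierTransform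

/-! ### The `L²` Fourier transform -/

/-! The number `E₀ W` separates the two sides. By `hylenicRatio_eq`, Λ(ψ) - E₀ is (½‖D^s ψ‖² + ∫
N(|ψ|)) / ‖ψ‖² with L² norms, so only the sign and size of the numerator matter.

Some Λ(ψ) lies below E₀: for a plateau f of height r₀, wide enough that ∫ N(|f|) < 0, the dilation
f(·/L) multiplies ∫ N by L but the kinetic term only by L^(1-2s), so the numerator is negative for
large L (`exists_hylenicRatio_lt`).

Vanishing sequences cannot go below E₀ in the limit. The key estimate is -∫ N(|u_n|) ≤ δ‖u_n‖²
eventually, for every δ > 0 (`IsVanishing.eventually_integral_le`). It is relative to the H^s norm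
because ‖u_n‖ itself may tend to 0; for δ ≤ ½ the kinetic term absorbs the D^s part
(`E₀_le_liminf`). To prove it, u_n is cut at frequency A. The value at x of the low part is a fixed
continuous functional applied to a translate of u_n, so vanishing makes it uniformly small. Where
|u_n| is not small, the high part therefore dominates, and its L² norm is small for large A.
Superquadraticity of N at 0 handles the remaining set, and the embedding into L^p handles large
values. -/

lemma norm_sq_eq_integral (f : L2) : ‖f‖ ^ 2 = ∫ x, ‖f x‖ ^ 2 := by
  have h : RCLike.re (inner ℂ f f) = ∫ x, ‖f x‖ ^ 2 := by
    rw [L2.inner_def]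
    have h2 : ∀ x, inner ℂ (f x) (f x) = ((‖f x‖ ^ 2 : ℝ) : ℂ) := fun x => by
      rw [inner_self_eq_norm_sq_to_K]; norm_cast
    simp_rw [h2]
    rw [integral_complex_ofReal]
    simp
  rw [← h, inner_self_eq_norm_sq]

lemma integrable_norm_sq (f : L2) : Integrable (fun x => ‖f x‖ ^ 2) :=
  (memLp_two_iff_integrable_sq_norm (Lp.aestronglyMeasurable f)).1 (Lp.memLp f)

lemma norm_toLp_sq {f : ℝ → ℂ} (hf : MemLp f 2 volume) : ‖hf.toLp f‖ ^ 2 = ∫ x, ‖f x‖ ^ 2 := by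
  rw [norm_sq_eq_integral]
  refine integral_congr_ae ?_
  filter_upwards [hf.coeFn_toLp] with x hx
  rw [hx]

/-- On `L¹ ∩ L²`, the inverse Fourier transform of `L²` is given by the integral. -/
lemma fourierL2_symm_ae_eq (g : L2) (hg : Integrable g) :
    fourierL2.symm g =ᵐ[volume] fun x => ∫ ξ, Real.fourierChar (ξ * x) • g ξ := by
  set F : ℝ → ℂ := fun x => ∫ ξ, Real.fourierChar (ξ * x) • g ξ with hF
  have hFeq : F = VectorFourier.fourierIntegral Real.fourierChar volume (-innerₗ ℝ) g := by
    ext x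
    simp [hF, VectorFourier.fourierIntegral, mul_comm]
  have hcont : Continuous fun p : ℝ × ℝ => (-innerₗ ℝ) p.1 p.2 := by
    simp only [LinearMap.neg_apply, innerₗ_apply_apply]; fun_prop
  have hFc : Continuous F := by
    rw [hFeq]
    exact VectorFourier.fourierIntegral_continuous Real.continuous_fourierChar hcont hg
  refine ae_eq_of_integral_contDiff_smul_eq
    ((Lp.memLp _).locallyIntegrable (by norm_num)) hFc.locallyIntegrable ?_
  intro φ hφ hφc
  have hc₁ : HasCompactSupport (Complex.ofRealCLM ∘ φ) := hφc.comp_left rfl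
  have hc₂ : ContDiff ℝ (⊤ : ℕ∞) (Complex.ofRealCLM ∘ φ) := by fun_prop
  set Φ := hc₁.toSchwartzMap hc₂ with hΦ
  have hΦx : ∀ x, Φ x = (φ x : ℂ) := fun x => rfl
  -- Both sides are paired with a test function by moving the transform onto it: here by the
  -- distributional definition, in `h3` by Fubini.
  have key := congrArg (fun T : TemperedDistribution ℝ ℂ => T Φ)
    (Lp.fourierInv_toTemperedDistribution_eq g)
  simp only [TemperedDistribution.fourierInv_apply, Lp.toTemperedDistribution_apply] at key
  have h1 : ∫ x, φ x • (fourierL2.symm g) x = ∫ x, Φ x • (fourierL2.symm g) x := by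
    refine integral_congr_ae (Eventually.of_forall fun x => ?_)
    simp [hΦx]
  have h2 : ∫ x, φ x • F x = ∫ x, F x • Φ x := by
    refine integral_congr_ae (Eventually.of_forall fun x => ?_)
    simp [hΦx, mul_comm]
  have h3 := VectorFourier.integral_fourierIntegral_smul_eq_flip (L := -innerₗ ℝ)
    Real.continuous_fourierChar hcont hg (Φ.integrable (μ := volume))
  rw [h1, h2, hFeq, h3]
  refine key.symm.trans (integral_congr_ae (Eventually.of_forall fun x => ?_))
  simp only [smul_eq_mul, mul_comm (g x)]
  congr 1
  rw [SchwartzMap.fourierInv_coe, Real.fourierInv_eq]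
  simp [VectorFourier.fourierIntegral, mul_comm]

/-! ### Splitting into low and high frequencies -/

/-- The part of `u` with frequencies in `[-A, A]`. -/
noncomputable def lowPass (A : ℝ) (u : L2) : L2 :=
  fourierL2.symm (((Lp.memLp (fourierL2 u)).indicator
    (measurableSet_Icc (a := -A) (b := A))).toLp _)

lemma fourierL2_lowPass (A : ℝ) (u : L2) :
    fourierL2 (lowPass A u) =ᵐ[volume] (Set.Icc (-A) A).indicator (fourierL2 u) := by
  rw [lowPass, LinearIsometryEquiv.apply_symm_apply]
  exact MemLp.coeFn_toLp _

lemma integrableOn_fourierL2 (A : ℝ) (u : L2) : IntegrableOn (fourierL2 u) (Set.Icc (-A) A) :=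
  ((Lp.memLp (fourierL2 u)).restrict _).integrable (by norm_num)

/-- The integral of the Fourier transform over `[-A, A]`: the value at `0` of `lowPass A u`. -/
noncomputable def lowValue (A : ℝ) (u : L2) : ℂ := ∫ ξ in Set.Icc (-A) A, fourierL2 u ξ

lemma norm_lowValue_le (A : ℝ) (u : L2) :
    ‖lowValue A u‖ ≤ ∫ ξ in Set.Icc (-A) A, ‖fourierL2 u ξ‖ := norm_integral_le_integral_norm _

/-- The character in the inversion integral at x is exactly the phase produced by translating by -x.
Pointwise values thus become one functional evaluated on translates, which is what vanishing
controls. -/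
lemma lowPass_ae_eq (A : ℝ) (u : L2) :
    lowPass A u =ᵐ[volume] fun x => lowValue A (translateL2 (-x) u) := by
  have hm := (Lp.memLp (fourierL2 u)).indicator (measurableSet_Icc (a := -A) (b := A))
  have hi : Integrable (hm.toLp _) := by
    rw [integrable_congr hm.coeFn_toLp, integrable_indicator_iff measurableSet_Icc]
    exact integrableOn_fourierL2 A u
  refine (fourierL2_symm_ae_eq _ hi).trans (Eventually.of_forall fun x => ?_)
  simp only [lowValue]
  rw [← integral_indicator measurableSet_Icc, fourierL2_translateL2]
  refine integral_congr_ae ?_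
  filter_upwards [hm.coeFn_toLp, (memLp_phase (-x) (fourierL2 u)).coeFn_toLp] with ξ h1 h2
  have h3 : (phaseL2 (-x) (fourierL2 u)) ξ = Real.fourierChar (-(-x * ξ)) • fourierL2 u ξ := h2
  rw [h1]
  by_cases hξ : ξ ∈ Set.Icc (-A) A
  · rw [Set.indicator_of_mem hξ, Set.indicator_of_mem hξ, h3]
    congr 2; ring
  · rw [Set.indicator_of_notMem hξ, Set.indicator_of_notMem hξ, smul_zero]

lemma integral_norm_fourierL2_translateL2 (A a : ℝ) (u : L2) :
    ∫ ξ in Set.Icc (-A) A, ‖fourierL2 (translateL2 a u) ξ‖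
      = ∫ ξ in Set.Icc (-A) A, ‖fourierL2 u ξ‖ :=
  integral_congr_ae (ae_restrict_of_ae (norm_fourier_translateL2 a u))

/-! ### Frequency bounds in `H^s` -/

lemma symbol_nonneg (s ξ : ℝ) : 0 ≤ symbol s ξ := Real.rpow_nonneg (abs_nonneg _) _

lemma symbol_sq (s ξ : ℝ) : symbol s ξ ^ 2 = |2 * Real.pi * ξ| ^ (2 * s) := by
  rw [symbol, ← Real.rpow_natCast, ← Real.rpow_mul (abs_nonneg _)]
  congr 1; push_cast; ring

/-- Since 2s ≥ 1, the H^s weight dominates that of H^(1/2); the frequency estimates below only use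
the weight 1 + |ξ|. -/
lemma one_add_abs_le {s : ℝ} (hs : 1 / 2 ≤ s) (ξ : ℝ) : 1 + |ξ| ≤ 2 * (1 + symbol s ξ ^ 2) := by
  rcases le_or_gt |ξ| 1 with h | h
  · nlinarith [sq_nonneg (symbol s ξ)]
  · have h1 : |ξ| ≤ |2 * Real.pi * ξ| := by
      rw [abs_mul, abs_of_pos Real.two_pi_pos]
      nlinarith [Real.pi_gt_three]
    have h3 : |2 * Real.pi * ξ| ≤ |2 * Real.pi * ξ| ^ (2 * s) :=
      Real.self_le_rpow_of_one_le (by linarith) (by linarith)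
    rw [symbol_sq]
    linarith

lemma norm_fracD_sq (s : ℝ) (u : Hs s) :
    ‖fracD s u‖ ^ 2 = ∫ ξ, symbol s ξ ^ 2 * ‖fourierL2 (toL2 s u) ξ‖ ^ 2 := by
  change ‖fourierL2.symm ((memLp_symbol_mul s u).toLp _)‖ ^ 2 = _
  rw [LinearIsometryEquiv.norm_map, norm_toLp_sq]
  simp [mul_pow]

lemma integrable_symbol_sq_mul (s : ℝ) (u : Hs s) :
    Integrable fun ξ => symbol s ξ ^ 2 * ‖fourierL2 (toL2 s u) ξ‖ ^ 2 := by
  have h := memLp_symbol_mul s u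
  refine ((memLp_two_iff_integrable_sq_norm h.1).1 h).congr (Eventually.of_forall fun ξ => ?_)
  simp [mul_pow]

lemma norm_toL2_le (s : ℝ) (u : Hs s) : ‖toL2 s u‖ ≤ ‖u‖ := by
  have := norm_sq_eq s u
  exact (sq_le_sq₀ (norm_nonneg _) (norm_nonneg _)).1 (by nlinarith [sq_nonneg ‖fracD s u‖])

lemma integrable_weight {s : ℝ} (hs : 1 / 2 ≤ s) (u : Hs s) :
    Integrable fun ξ => (1 + |ξ|) * ‖fourierL2 (toL2 s u) ξ‖ ^ 2 := by
  refine (((integrable_norm_sq (fourierL2 (toL2 s u))).add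
    (integrable_symbol_sq_mul s u)).const_mul 2).mono' ?_ (Eventually.of_forall fun ξ => ?_)
  · exact (by fun_prop : Continuous fun ξ : ℝ => 1 + |ξ|).aestronglyMeasurable.mul
      ((Lp.aestronglyMeasurable _).norm.pow 2)
  · rw [Real.norm_of_nonneg (by positivity)]
    have := mul_le_mul_of_nonneg_right (one_add_abs_le hs ξ)
      (sq_nonneg ‖fourierL2 (toL2 s u) ξ‖)
    simp only [Pi.add_apply]
    linarith

lemma integral_weight_le {s : ℝ} (hs : 1 / 2 ≤ s) (u : Hs s) :
    ∫ ξ, (1 + |ξ|) * ‖fourierL2 (toL2 s u) ξ‖ ^ 2 ≤ 2 * ‖u‖ ^ 2 := by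
  rw [norm_sq_eq, ← fourierL2.norm_map (toL2 s u), norm_sq_eq_integral (fourierL2 (toL2 s u)),
    norm_fracD_sq, ← integral_add (integrable_norm_sq _) (integrable_symbol_sq_mul s u),
    ← integral_const_mul]
  refine integral_mono (integrable_weight hs u) (((integrable_norm_sq _).add
    (integrable_symbol_sq_mul s u)).const_mul 2) fun ξ => ?_
  have := mul_le_mul_of_nonneg_right (one_add_abs_le hs ξ)
    (sq_nonneg ‖fourierL2 (toL2 s u) ξ‖)
  linarith

lemma norm_sub_lowPass_sq_le {s : ℝ} (hs : 1 / 2 ≤ s) (u : Hs s) {A : ℝ} (hA : 0 ≤ A) :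
    ‖toL2 s u - lowPass A (toL2 s u)‖ ^ 2 ≤ 2 * ‖u‖ ^ 2 / (1 + A) := by
  rw [le_div_iff₀ (by linarith)]
  refine le_trans ?_ (integral_weight_le hs u)
  rw [← fourierL2.norm_map, norm_sq_eq_integral, ← integral_mul_const]
  refine integral_mono_ae ((integrable_norm_sq _).mul_const _) (integrable_weight hs u) ?_
  rw [map_sub]
  filter_upwards [Lp.coeFn_sub (fourierL2 (toL2 s u)) (fourierL2 (lowPass A (toL2 s u))),
    fourierL2_lowPass A (toL2 s u)] with ξ h1 h2
  rw [h1, Pi.sub_apply, h2]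
  by_cases hξ : ξ ∈ Set.Icc (-A) A
  · rw [Set.indicator_of_mem hξ]
    rw [sub_self, norm_zero]
    have := abs_nonneg ξ
    simp only [ne_eq, OfNat.ofNat_ne_zero, not_false_eq_true, zero_pow, zero_mul]
    positivity
  · rw [Set.indicator_of_notMem hξ, sub_zero, mul_comm]
    refine mul_le_mul_of_nonneg_right ?_ (sq_nonneg _)
    rw [Set.mem_Icc, ← abs_le] at hξ
    linarith

lemma integral_inv_one_add_abs {A : ℝ} (hA : 0 ≤ A) :
    ∫ ξ in Set.Icc (-A) A, (1 + |ξ|)⁻¹ = 2 * Real.log (1 + A) := by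
  have hc : Continuous fun ξ : ℝ => (1 + |ξ|)⁻¹ :=
    Continuous.inv₀ (by fun_prop) fun ξ => by positivity
  have h1 : ∫ ξ in (0 : ℝ)..A, (1 + |ξ|)⁻¹ = Real.log (1 + A) := by
    have : ∀ ξ ∈ Set.uIcc 0 A, HasDerivAt (fun ξ => Real.log (1 + ξ)) (1 + ξ)⁻¹ ξ := by
      intro ξ hξ
      rw [Set.uIcc_of_le hA] at hξ
      have := ((hasDerivAt_id ξ).const_add 1).log (by simp; linarith [hξ.1])
      simpa using this
    rw [intervalIntegral.integral_congr (g := fun ξ => (1 + ξ)⁻¹)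
      (fun ξ hξ => by
        rw [Set.uIcc_of_le hA] at hξ
        simp only [abs_of_nonneg hξ.1]),
      intervalIntegral.integral_eq_sub_of_hasDerivAt this]
    · simp
    · refine ContinuousOn.intervalIntegrable (ContinuousOn.inv₀ (by fun_prop) ?_)
      intro ξ hξ
      rw [Set.uIcc_of_le hA] at hξ
      linarith [hξ.1]
  have h2 : ∫ ξ in (-A)..(0 : ℝ), (1 + |ξ|)⁻¹ = Real.log (1 + A) := by
    have := intervalIntegral.integral_comp_neg (a := -A) (b := 0) fun ξ : ℝ => (1 + |ξ|)⁻¹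
    simp only [abs_neg, neg_neg, neg_zero] at this
    rw [this, h1]
  rw [integral_Icc_eq_integral_Ioc, ← intervalIntegral.integral_of_le (by linarith),
    ← intervalIntegral.integral_add_adjacent_intervals (hc.intervalIntegrable _ 0)
      (hc.intervalIntegrable _ _), h1, h2]
  ring

/-- Young's inequality y ≤ t/(2w) + w y²/(2t) with weight w = 1 + |ξ|. The cost in A is only
logarithmic, so cutoffs exponential in the square of the height are affordable. -/
lemma integral_norm_fourierL2_le {s : ℝ} (hs : 1 / 2 ≤ s) (u : Hs s) {A t : ℝ} (hA : 0 ≤ A)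
    (ht : 0 < t) :
    ∫ ξ in Set.Icc (-A) A, ‖fourierL2 (toL2 s u) ξ‖
      ≤ t * Real.log (1 + A) + ‖u‖ ^ 2 / t := by
  have hc : Continuous fun ξ : ℝ => (1 + |ξ|)⁻¹ :=
    Continuous.inv₀ (by fun_prop) fun ξ => by positivity
  have i1 : IntegrableOn (fun ξ : ℝ => t / 2 * (1 + |ξ|)⁻¹) (Set.Icc (-A) A) :=
    (hc.integrableOn_Icc).const_mul _
  have i2 : Integrable fun ξ => (2 * t)⁻¹ * ((1 + |ξ|) * ‖fourierL2 (toL2 s u) ξ‖ ^ 2) :=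
    (integrable_weight hs u).const_mul _
  have h1 : ∫ ξ in Set.Icc (-A) A, (2 * t)⁻¹ * ((1 + |ξ|) * ‖fourierL2 (toL2 s u) ξ‖ ^ 2)
      ≤ (2 * t)⁻¹ * (2 * ‖u‖ ^ 2) := by
    refine (setIntegral_le_integral i2 (Eventually.of_forall fun ξ => by
      simp only [Pi.zero_apply]; positivity)).trans ?_
    rw [integral_const_mul]
    exact mul_le_mul_of_nonneg_left (integral_weight_le hs u) (by positivity)
  calc _ ≤ ∫ ξ in Set.Icc (-A) A, (t / 2 * (1 + |ξ|)⁻¹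
        + (2 * t)⁻¹ * ((1 + |ξ|) * ‖fourierL2 (toL2 s u) ξ‖ ^ 2)) := by
        refine integral_mono (integrableOn_fourierL2 A _).norm (i1.add i2.integrableOn) fun ξ => ?_
        have hp : 0 < 1 + |ξ| := by positivity
        set y := ‖fourierL2 (toL2 s u) ξ‖
        have : t / 2 * (1 + |ξ|)⁻¹ + (2 * t)⁻¹ * ((1 + |ξ|) * y ^ 2) - y
            = (t - (1 + |ξ|) * y) ^ 2 / (2 * t * (1 + |ξ|)) := by
          field_simp; ring
        have h0 : 0 ≤ (t - (1 + |ξ|) * y) ^ 2 / (2 * t * (1 + |ξ|)) := by positivity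
        linarith
    _ ≤ _ := by
        rw [integral_add i1 i2.integrableOn, integral_const_mul, integral_inv_one_add_abs hA]
        have : (2 * t)⁻¹ * (2 * ‖u‖ ^ 2) = ‖u‖ ^ 2 / t := by field_simp
        linarith

/-! ### The embedding `H^s ⊂ L^p` -/

lemma volume_ge_le (f : L2) {a : ℝ} (ha : 0 < a) :
    volume {x | a ≤ ‖f x‖} ≤ ENNReal.ofReal (‖f‖ ^ 2 / a ^ 2) := by
  rw [ENNReal.ofReal_div_of_pos (by positivity), norm_sq_eq_integral,
    ofReal_integral_eq_lintegral_ofReal (integrable_norm_sq f)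
      (Eventually.of_forall fun x => by positivity)]
  refine le_trans (measure_mono fun x hx => ?_) (meas_ge_le_lintegral_div
    (integrable_norm_sq f).1.aemeasurable.ennreal_ofReal
    (by simpa using ha.ne') ENNReal.ofReal_ne_top)
  exact ENNReal.ofReal_le_ofReal (pow_le_pow_left₀ ha.le hx 2)

lemma ae_norm_le_add (A : ℝ) (u : L2) : ∀ᵐ x, ‖u x‖ ≤
    ‖lowValue A (translateL2 (-x) u)‖ + ‖(u - lowPass A u : L2) x‖ := by
  filter_upwards [lowPass_ae_eq A u, Lp.coeFn_sub u (lowPass A u)] with x h1 h2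
  rw [h2, Pi.sub_apply, ← h1]
  simpa using norm_add_le (lowPass A u x) (u x - lowPass A u x)

/-- A Trudinger–Moser type tail: with a cutoff depending on t the low part stays below t/2, so the
high part must exceed t/2, and Chebyshev applies to it. -/
lemma volume_lt_le {s : ℝ} (hs : 1 / 2 ≤ s) {u : Hs s} (hu : ‖u‖ ≤ 1) {t : ℝ} (ht : 0 < t) :
    volume {x | t < ‖toL2 s u x‖} ≤
      ENNReal.ofReal (8 / t ^ 2 * Real.exp (-(1 / 16) * t ^ 2)) := by
  -- Chosen so that log(1 + A) = t²/16; with parameter 4/t both terms of the low-frequency bound are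
  -- then at most t/4.
  set A := Real.exp (t ^ 2 / 16) - 1 with hA
  have hA0 : 0 ≤ A := by
    have := Real.one_le_exp (x := t ^ 2 / 16) (by positivity)
    linarith
  have hA1 : 1 + A = Real.exp (t ^ 2 / 16) := by rw [hA]; ring
  have hu2 : ‖u‖ ^ 2 ≤ 1 := pow_le_one₀ (norm_nonneg _) hu
  have hlow : ∀ x, ‖lowValue A (translateL2 (-x) (toL2 s u))‖ ≤ t / 2 := fun x => by
    refine (norm_lowValue_le _ _).trans ?_
    rw [integral_norm_fourierL2_translateL2]
    refine (integral_norm_fourierL2_le hs u hA0 (t := 4 / t) (by positivity)).trans ?_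
    rw [hA1, Real.log_exp]
    have h1 : 4 / t * (t ^ 2 / 16) = t / 4 := by field_simp; norm_num
    have h2 : ‖u‖ ^ 2 / (4 / t) ≤ t / 4 := by
      rw [div_div_eq_mul_div]
      nlinarith
    linarith
  have hsub : volume {x | t < ‖toL2 s u x‖} ≤
      volume {x | t / 2 ≤ ‖(toL2 s u - lowPass A (toL2 s u) : L2) x‖} := by
    refine measure_mono_ae ?_
    filter_upwards [ae_norm_le_add A (toL2 s u)] with x hx hxt
    have h1 : t < ‖toL2 s u x‖ := hxt
    have h2 := hlow x
    change t / 2 ≤ _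
    linarith
  refine hsub.trans ((volume_ge_le _ (by positivity)).trans (ENNReal.ofReal_le_ofReal ?_))
  have h3 := norm_sub_lowPass_sq_le hs u hA0
  rw [hA1] at h3
  have h4 : 2 * ‖u‖ ^ 2 / Real.exp (t ^ 2 / 16) ≤ 2 * Real.exp (-(1 / 16) * t ^ 2) := by
    rw [show -(1 / 16) * t ^ 2 = -(t ^ 2 / 16) by ring, Real.exp_neg, ← div_eq_mul_inv]
    gcongr
    linarith
  calc _ ≤ 2 * Real.exp (-(1 / 16) * t ^ 2) / (t / 2) ^ 2 := by gcongr; exact h3.trans h4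
    _ = _ := by field_simp; norm_num

/-- Layer cake with the Gaussian tail; its factor t⁻² leaves t^(p-3), integrable at 0 because p > 2.
-/
lemma exists_lintegral_rpow_le_of_norm_le_one {s : ℝ} (hs : 1 / 2 ≤ s) {p : ℝ} (hp : 2 < p) :
    ∃ C : ℝ, 0 ≤ C ∧ ∀ u : Hs s, ‖u‖ ≤ 1 →
      ∫⁻ x, ENNReal.ofReal (‖toL2 s u x‖ ^ p) ≤ ENNReal.ofReal C := by
  have hint : IntegrableOn (fun t : ℝ => 8 * (t ^ (p - 3) * Real.exp (-(1 / 16) * t ^ 2)))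
      (Set.Ioi 0) :=
    (integrableOn_rpow_mul_exp_neg_mul_sq (by norm_num) (by linarith)).const_mul _
  refine ⟨p * ∫ t in Set.Ioi (0 : ℝ), 8 * (t ^ (p - 3) * Real.exp (-(1 / 16) * t ^ 2)), ?_, ?_⟩
  · refine mul_nonneg (by linarith) (setIntegral_nonneg measurableSet_Ioi fun t ht => ?_)
    have : 0 < t := ht
    positivity
  · intro u hu
    rw [lintegral_rpow_eq_lintegral_meas_lt_mul volume
      (Eventually.of_forall fun x => norm_nonneg _)
      (Lp.aestronglyMeasurable _).norm.aemeasurable (by linarith),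
      ENNReal.ofReal_mul (by linarith)]
    gcongr
    rw [ofReal_integral_eq_lintegral_ofReal hint]
    · refine setLIntegral_mono_ae' measurableSet_Ioi (Eventually.of_forall fun t ht => ?_)
      have ht : 0 < t := ht
      refine (mul_le_mul_left (volume_lt_le hs hu ht) _).trans ?_
      rw [← ENNReal.ofReal_mul (by positivity)]
      refine ENNReal.ofReal_le_ofReal (le_of_eq ?_)
      rw [show p - 1 = (p - 3) + 2 by ring, Real.rpow_add ht, Real.rpow_two]
      field_simp
    · filter_upwards [ae_restrict_mem measurableSet_Ioi] with t ht
      have : 0 < t := ht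
      simp only [Pi.zero_apply]
      positivity

/-- `H^s` embeds into `L^p` for `s ≥ 1/2` and `2 < p < ∞`. -/
lemma exists_integral_rpow_le {s : ℝ} (hs : 1 / 2 ≤ s) {p : ℝ} (hp : 2 < p) :
    ∃ C : ℝ, 0 ≤ C ∧ ∀ u : Hs s, Integrable (fun x => ‖toL2 s u x‖ ^ p) ∧
      ∫ x, ‖toL2 s u x‖ ^ p ≤ C * ‖u‖ ^ p := by
  obtain ⟨C, hC, h⟩ := exists_lintegral_rpow_le_of_norm_le_one hs hp
  refine ⟨C, hC, fun u => ?_⟩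
  have key : ∫⁻ x, ENNReal.ofReal (‖toL2 s u x‖ ^ p) ≤ ENNReal.ofReal (C * ‖u‖ ^ p) := by
    -- Reduction to the unit ball by homogeneity; for u = 0 the convention 0⁻¹ = 0 gives v = 0,
    -- which is harmless.
    set v : Hs s := ((‖u‖⁻¹ : ℝ) : ℂ) • u with hv
    have hv1 : ‖v‖ ≤ 1 := by
      rw [hv, norm_smul, Complex.norm_real, norm_inv, norm_norm]
      exact inv_mul_le_one
    have hu : u = ((‖u‖ : ℝ) : ℂ) • v := by
      rcases eq_or_ne u 0 with h0 | h0
      · simp [h0]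
      · rw [hv, smul_smul, ← Complex.ofReal_mul, mul_inv_cancel₀ (norm_ne_zero_iff.2 h0)]
        simp
    have hae : ∀ᵐ x, ENNReal.ofReal (‖toL2 s u x‖ ^ p)
        = ENNReal.ofReal (‖u‖ ^ p) * ENNReal.ofReal (‖toL2 s v x‖ ^ p) := by
      have hu' : toL2 s u = ((‖u‖ : ℝ) : ℂ) • toL2 s v := by rw [← map_smul, ← hu]
      filter_upwards [Lp.coeFn_smul ((‖u‖ : ℝ) : ℂ) (toL2 s v)] with x hx
      rw [hu', hx, Pi.smul_apply, norm_smul, Complex.norm_real, norm_norm,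
        Real.mul_rpow (norm_nonneg _) (norm_nonneg _), ENNReal.ofReal_mul (by positivity)]
    rw [lintegral_congr_ae hae, lintegral_const_mul' _ _ ENNReal.ofReal_ne_top, mul_comm C,
      ENNReal.ofReal_mul (by positivity)]
    gcongr
    exact h v hv1
  have hm : AEStronglyMeasurable (fun x => ‖toL2 s u x‖ ^ p) volume :=
    ((Lp.aestronglyMeasurable (toL2 s u)).norm.aemeasurable.pow_const p).aestronglyMeasurable
  have hi : Integrable (fun x => ‖toL2 s u x‖ ^ p) := by
    refine (lintegral_ofReal_ne_top_iff_integrable hm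
      (Eventually.of_forall fun x => by positivity)).1 ?_
    exact (key.trans_lt ENNReal.ofReal_lt_top).ne
  refine ⟨hi, ?_⟩
  rw [← ENNReal.ofReal_le_ofReal_iff (by positivity), ofReal_integral_eq_lintegral_ofReal hi
    (Eventually.of_forall fun x => by positivity)]
  exact key

/-! ### Vanishing sequences -/

lemma translate_zero (s : ℝ) (u : Hs s) : translate s 0 u = u := by
  refine toL2_injective s (Lp.ext ?_)
  filter_upwards [coeFn_translate s 0 u] with x hx
  rw [hx, sub_zero]

/-- Zero shifts give weak convergence, and the uniform boundedness principle applies to the u_n seen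
as functionals on the dual, which is always complete. -/
lemma IsVanishing.exists_norm_le {s : ℝ} {u : ℕ → Hs s} (hu : IsVanishing s u) :
    ∃ M : ℝ, ∀ n, ‖u n‖ ≤ M := by
  obtain ⟨M, hM⟩ := banach_steinhaus
    (g := fun n => NormedSpace.inclusionInDoubleDual ℂ (Hs s) (u n))
    (fun ℓ => by
      have h := hu 0 ℓ
      simp only [Pi.zero_apply, translate_zero] at h
      obtain ⟨C, hC⟩ := h.norm.bddAbove_range
      exact ⟨C, fun n => by simpa using hC ⟨n, rfl⟩⟩)
  refine ⟨M, fun n => ?_⟩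
  rw [← (NormedSpace.inclusionInDoubleDualLi ℂ (E := Hs s)).norm_map]
  exact hM n

/-- The functional `u ↦ lowValue A u` on `H^s`. -/
noncomputable def lowFunctional (s A : ℝ) : Hs s →L[ℂ] ℂ :=
  (innerSL ℂ (indicatorConstLp (E := ℂ) 2 (measurableSet_Icc (a := -A) (b := A))
    measure_Icc_lt_top.ne 1)).comp ((fourierL2.toContinuousLinearEquiv : L2 →L[ℂ] L2).comp
      ((toL2 s).mkContinuous 1 fun u => by simpa using norm_toL2_le s u))

lemma lowFunctional_apply (s A : ℝ) (u : Hs s) : lowFunctional s A u = lowValue A (toL2 s u) :=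
  L2.inner_indicatorConstLp_one _ _ (fourierL2 (toL2 s u))

/-- Uniformity in x comes from the freedom in the shifts: the n-th shift is taken at a point
violating the bound whenever there is one, and vanishing along these shifts excludes violations for
large n. -/
lemma IsVanishing.eventually_norm_lowValue_le {s : ℝ} {u : ℕ → Hs s} (hu : IsVanishing s u)
    (A : ℝ) {ε : ℝ} (hε : 0 < ε) :
    ∀ᶠ n in atTop, ∀ x, ‖lowValue A (translateL2 (-x) (toL2 s (u n)))‖ ≤ ε := by
  classical
  have hex : ∀ n, ∃ a : ℝ, ‖lowValue A (translateL2 a (toL2 s (u n)))‖ ≤ ε →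
      ∀ x, ‖lowValue A (translateL2 (-x) (toL2 s (u n)))‖ ≤ ε := by
    intro n
    by_cases h : ∀ x, ‖lowValue A (translateL2 (-x) (toL2 s (u n)))‖ ≤ ε
    · exact ⟨0, fun _ => h⟩
    · push Not at h
      obtain ⟨x, hx⟩ := h
      exact ⟨-x, fun h => absurd h (not_le.2 hx)⟩
  choose a ha using hex
  have h := (hu a (lowFunctional s A)).norm
  simp only [map_zero, norm_zero] at h
  filter_upwards [h.eventually_le_const hε] with n hn
  rw [lowFunctional_apply] at hn
  exact ha n hn

/-- A nonlinearity that is superquadratic at `0` and of polynomial growth is negligible with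
respect to `‖·‖²` along vanishing sequences. -/
lemma IsVanishing.eventually_integral_le {s : ℝ} (hs : 1 / 2 ≤ s) {u : ℕ → Hs s}
    (hu : IsVanishing s u) {G : ℝ → ℝ} {q : ℝ} (hq : 1 < q)
    (hG : ∀ δ > 0, ∃ η > 0, ∃ K, 0 ≤ K ∧ ∀ r, 0 ≤ r →
      (r ≤ η → G r ≤ δ * r ^ 2) ∧ (η < r → G r ≤ K * (r * r ^ q)))
    (hGi : ∀ n, Integrable fun x => G ‖toL2 s (u n) x‖) {δ : ℝ} (hδ : 0 < δ) :
    ∀ᶠ n in atTop, ∫ x, G ‖toL2 s (u n) x‖ ≤ δ * ‖u n‖ ^ 2 := by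
  obtain ⟨M, hM⟩ := hu.exists_norm_le
  obtain ⟨C, hC, hSob⟩ := exists_integral_rpow_le hs (p := 2 * q) (by linarith)
  obtain ⟨η, hη, K, hK, hGK⟩ := hG (δ / 3) (by positivity)
  have hM0 : 0 ≤ M := (norm_nonneg _).trans (hM 0)
  -- The budget δ‖u n‖² is split into thirds: θ makes K·θ·B ≤ δ/3 for the L^(2q) term, then A makes
  -- (K/θ)·2/(1 + A) ≤ δ/3 for the high frequencies.
  set B := C * M ^ (2 * q - 2) with hB
  have hB0 : 0 ≤ B := by positivity
  set θ := δ / (3 * (K * B + 1)) with hθ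
  have hθ0 : 0 < θ := by positivity
  set A := 6 * K / (θ * δ) with hA
  have hA0 : 0 ≤ A := by positivity
  filter_upwards [hu.eventually_norm_lowValue_le A (half_pos hη)] with n hn
  set f := toL2 s (u n)
  set w : L2 := f - lowPass A f
  have hi1 := (integrable_norm_sq f).const_mul (δ / 3)
  have hi2 := (integrable_norm_sq w).const_mul (K / θ)
  have hi3 := (hSob (u n)).1.const_mul (K * θ)
  have hpt : ∀ᵐ x, G ‖f x‖ ≤ δ / 3 * ‖f x‖ ^ 2 + K / θ * ‖w x‖ ^ 2
      + K * θ * ‖f x‖ ^ (2 * q) := by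
    filter_upwards [ae_norm_le_add A f] with x hx
    have hx' : ‖f x‖ ≤ η / 2 + ‖w x‖ := hx.trans (add_le_add (hn x) le_rfl)
    set r := ‖f x‖
    have hr : 0 ≤ r := norm_nonneg _
    set y := ‖w x‖
    have hy : 0 ≤ y := norm_nonneg _
    rcases le_or_gt r η with h | h
    · have := (hGK r hr).1 h
      have h2 : 0 ≤ K / θ * y ^ 2 := by positivity
      have h3 : 0 ≤ K * θ * r ^ (2 * q) := by positivity
      linarith
    -- The low part is at most η/2 < r/2, so r ≤ 2y. One factor r is replaced by 2y, and 2y·r^q ≤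
    -- y²/θ + θ·r^(2q).
    · have h1 := (hGK r hr).2 h
      have h2 : r ≤ 2 * y := by linarith
      have h3 : r ^ (2 * q) = (r ^ q) ^ 2 := by
        rw [← Real.rpow_natCast, ← Real.rpow_mul hr]
        congr 1; push_cast; ring
      have h4 : K * (r * r ^ q) ≤ K * (2 * y * r ^ q) := by gcongr
      have h5 : K / θ * y ^ 2 + K * θ * (r ^ q) ^ 2 - K * (2 * y * r ^ q)
          = K / θ * (y - θ * r ^ q) ^ 2 := by field_simp; ring
      have h6 : 0 ≤ K / θ * (y - θ * r ^ q) ^ 2 := by positivity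
      have h7 : 0 ≤ δ / 3 * r ^ 2 := by positivity
      rw [h3]
      linarith
  have hi12 : Integrable fun x => δ / 3 * ‖f x‖ ^ 2 + K / θ * ‖w x‖ ^ 2 := hi1.add hi2
  refine (integral_mono_ae (g := fun x => δ / 3 * ‖f x‖ ^ 2 + K / θ * ‖w x‖ ^ 2
    + K * θ * ‖f x‖ ^ (2 * q)) (hGi n) (hi12.add hi3) hpt).trans ?_
  rw [integral_add hi12 hi3, integral_add hi1 hi2, integral_const_mul, integral_const_mul,
    integral_const_mul, ← norm_sq_eq_integral, ← norm_sq_eq_integral]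
  have e1 : δ / 3 * ‖f‖ ^ 2 ≤ δ / 3 * ‖u n‖ ^ 2 := by
    have := norm_toL2_le s (u n)
    gcongr
  have e2 : K / θ * ‖w‖ ^ 2 ≤ δ / 3 * ‖u n‖ ^ 2 := by
    have h1 : ‖w‖ ^ 2 ≤ 2 * ‖u n‖ ^ 2 / (1 + A) := norm_sub_lowPass_sq_le hs (u n) hA0
    have h2 : K / θ * (2 * ‖u n‖ ^ 2 / (1 + A)) = (2 * K / θ) / (1 + A) * ‖u n‖ ^ 2 := by
      field_simp
    have h3 : (2 * K / θ) / (1 + A) ≤ δ / 3 := by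
      rw [div_le_iff₀ (by positivity)]
      have : δ / 3 * A = 2 * K / θ := by rw [hA]; field_simp; ring
      linarith
    calc _ ≤ K / θ * (2 * ‖u n‖ ^ 2 / (1 + A)) := by gcongr
      _ = _ := h2
      _ ≤ _ := by gcongr
  have e3 : K * θ * ∫ x, ‖f x‖ ^ (2 * q) ≤ δ / 3 * ‖u n‖ ^ 2 := by
    have h1 : ‖u n‖ ^ (2 * q) = ‖u n‖ ^ (2 * q - 2) * ‖u n‖ ^ 2 := by
      rw [← Real.rpow_two, ← Real.rpow_add' (norm_nonneg _) (by linarith)]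
      congr 1; ring
    have h2 : ‖u n‖ ^ (2 * q - 2) ≤ M ^ (2 * q - 2) :=
      Real.rpow_le_rpow (norm_nonneg _) (hM n) (by linarith)
    have h3 : K * θ * B ≤ δ / 3 := by
      rw [hθ, mul_div_assoc', div_mul_eq_mul_div, div_le_div_iff₀ (by positivity) (by norm_num)]
      nlinarith
    calc _ ≤ K * θ * (C * ‖u n‖ ^ (2 * q)) := by gcongr; exact (hSob (u n)).2
      _ = K * θ * (C * ‖u n‖ ^ (2 * q - 2)) * ‖u n‖ ^ 2 := by rw [h1]; ring
      _ ≤ K * θ * B * ‖u n‖ ^ 2 := by rw [hB]; gcongr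
      _ ≤ _ := by gcongr
  linarith

/-! ### The nonlinearity -/

lemma differentiableOn_N {W : ℝ → ℝ} (hW : ContDiffOn ℝ 2 W (Set.Ici 0)) :
    DifferentiableOn ℝ (N W) (Set.Ici 0) :=
  (hW.differentiableOn (by norm_num)).sub (by fun_prop)

lemma continuous_N_norm {W : ℝ → ℝ} (hW : ContDiffOn ℝ 2 W (Set.Ici 0)) :
    Continuous fun z : ℂ => N W ‖z‖ :=
  (differentiableOn_N hW).continuousOn.comp_continuous continuous_norm fun z => norm_nonneg z

/-- Mean value inequality on [0, r]: the bound on the derivative is increasing, so its value at r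
serves throughout. -/
lemma abs_N_le {W : ℝ → ℝ} (hW : ContDiffOn ℝ 2 W (Set.Ici 0)) (hW0 : W 0 = 0)
    {q₁ q₂ c : ℝ} (hq₁ : 2 < q₁) (hq₂ : 2 < q₂)
    (h : ∀ r : ℝ, 0 ≤ r →
      |derivWithin (N W) (Set.Ici 0) r| ≤ c * (r ^ (q₁ - 1) + r ^ (q₂ - 1)))
    {r : ℝ} (hr : 0 ≤ r) : |N W r| ≤ c * (r ^ q₁ + r ^ q₂) := by
  -- The sign of c is not assumed; it follows from the bound at r = 1.
  have hc : 0 ≤ c := by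
    have := (abs_nonneg _).trans (h 1 zero_le_one)
    simp only [Real.one_rpow] at this
    linarith
  have key := (convex_Icc 0 r).norm_image_sub_le_of_norm_hasDerivWithin_le (f := N W)
    (f' := derivWithin (N W) (Set.Ici 0)) (C := c * (r ^ (q₁ - 1) + r ^ (q₂ - 1)))
    (fun x hx => ((differentiableOn_N hW x hx.1).hasDerivWithinAt).mono Set.Icc_subset_Ici_self)
    (fun x hx => (h x hx.1).trans (by
      have h1 := Real.rpow_le_rpow hx.1 hx.2 (by linarith : 0 ≤ q₁ - 1)
      have h2 := Real.rpow_le_rpow hx.1 hx.2 (by linarith : 0 ≤ q₂ - 1)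
      gcongr)) (Set.left_mem_Icc.2 hr) (Set.right_mem_Icc.2 hr)
  have hN0 : N W 0 = 0 := by simp [N, hW0]
  rw [hN0, sub_zero, sub_zero, Real.norm_eq_abs, Real.norm_of_nonneg hr] at key
  refine key.trans (le_of_eq ?_)
  have e : ∀ q : ℝ, 2 < q → r ^ q = r ^ (q - 1) * r := fun q hq => by
    conv_rhs => rw [← Real.rpow_one r, ← Real.rpow_mul hr, one_mul,
      ← Real.rpow_add' hr (by linarith)]
    congr 1; ring
  rw [e q₁ hq₁, e q₂ hq₂]
  ring

/-- Near 0 the factor r^(q₁-2) is small; away from 0 both powers are dominated by r^(q₂+1). The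
latter is written r·r^q₂ because one factor is later traded for the high-frequency part. -/
lemma exists_quadratic_or_power_bound {G : ℝ → ℝ} {q₁ q₂ c : ℝ} (hq₁ : 2 < q₁) (hq : q₁ ≤ q₂)
    (hc : 0 ≤ c) (h : ∀ r, 0 ≤ r → G r ≤ c * (r ^ q₁ + r ^ q₂)) {δ : ℝ} (hδ : 0 < δ) :
    ∃ η > 0, ∃ K, 0 ≤ K ∧ ∀ r, 0 ≤ r →
      (r ≤ η → G r ≤ δ * r ^ 2) ∧ (η < r → G r ≤ K * (r * r ^ q₂)) := by
  -- κ ensures 2cκ ≤ δ, the added 1 covering c = 0; η ≤ 1 lets r^q₁ dominate r^q₂ on [0, η].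
  set κ := δ / (2 * c + 1) with hκ
  have hκ0 : 0 < κ := by positivity
  set η := min 1 (κ ^ (q₁ - 2)⁻¹) with hη
  have hη0 : 0 < η := lt_min one_pos (by positivity)
  have hη1 : η ^ (q₁ - 2) ≤ κ := by
    calc _ ≤ (κ ^ (q₁ - 2)⁻¹) ^ (q₁ - 2) :=
          Real.rpow_le_rpow hη0.le (min_le_right _ _) (by linarith)
      _ = κ := by
          rw [← Real.rpow_mul hκ0.le, inv_mul_cancel₀ (by linarith), Real.rpow_one]
  refine ⟨η, hη0, c * (η ^ (q₁ - q₂ - 1) + η ^ (-1 : ℝ)), by positivity,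
    fun r hr => ⟨fun hle => (h r hr).trans ?_, fun hlt => (h r hr).trans ?_⟩⟩
  · have hr1 : r ≤ 1 := hle.trans (min_le_left _ _)
    have h1 : r ^ q₂ ≤ r ^ q₁ := Real.rpow_le_rpow_of_exponent_ge' hr hr1 (by linarith) hq
    have h2 : r ^ q₁ = r ^ (q₁ - 2) * r ^ 2 := by
      rw [← Real.rpow_two, ← Real.rpow_add' hr (by linarith)]
      congr 1; ring
    have h3 : r ^ (q₁ - 2) ≤ κ := (Real.rpow_le_rpow hr hle (by linarith)).trans hη1
    have h4 : 2 * c * κ ≤ δ := by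
      rw [hκ, mul_div_assoc', div_le_iff₀ (by positivity)]
      nlinarith
    calc c * (r ^ q₁ + r ^ q₂) ≤ c * (r ^ q₁ + r ^ q₁) := by gcongr
      _ = 2 * c * r ^ (q₁ - 2) * r ^ 2 := by rw [h2]; ring
      _ ≤ 2 * c * κ * r ^ 2 := by gcongr
      _ ≤ δ * r ^ 2 := by gcongr
  · have hr0 : 0 < r := hη0.trans hlt
    have e : r * r ^ q₂ = r ^ (q₂ + 1) := by rw [Real.rpow_add_one hr0.ne', mul_comm]
    have h1 : r ^ q₁ ≤ η ^ (q₁ - q₂ - 1) * r ^ (q₂ + 1) := by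
      have : r ^ q₁ = r ^ (q₁ - q₂ - 1) * r ^ (q₂ + 1) := by
        rw [← Real.rpow_add hr0]; congr 1; ring
      rw [this]
      exact mul_le_mul_of_nonneg_right
        (Real.rpow_le_rpow_of_nonpos hη0 hlt.le (by linarith)) (by positivity)
    have h2 : r ^ q₂ ≤ η ^ (-1 : ℝ) * r ^ (q₂ + 1) := by
      have : r ^ q₂ = r ^ (-1 : ℝ) * r ^ (q₂ + 1) := by
        rw [← Real.rpow_add hr0]; congr 1; ring
      rw [this]
      exact mul_le_mul_of_nonneg_right
        (Real.rpow_le_rpow_of_nonpos hη0 hlt.le (by norm_num)) (by positivity)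
    rw [e, mul_assoc]
    gcongr
    linarith

lemma integrable_N_norm {s : ℝ} (hs : 1 / 2 ≤ s) {W : ℝ → ℝ} (hW : ContDiffOn ℝ 2 W (Set.Ici 0))
    {q₁ q₂ c : ℝ} (hq₁ : 2 < q₁) (hq₂ : 2 < q₂)
    (h : ∀ r, 0 ≤ r → |N W r| ≤ c * (r ^ q₁ + r ^ q₂)) (ψ : Hs s) :
    Integrable fun x => N W ‖toL2 s ψ x‖ := by
  obtain ⟨_, _, h1⟩ := exists_integral_rpow_le hs hq₁
  obtain ⟨_, _, h2⟩ := exists_integral_rpow_le hs hq₂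
  exact (((h1 ψ).1.add (h2 ψ).1).const_mul c).mono'
    ((continuous_N_norm hW).comp_aestronglyMeasurable (Lp.aestronglyMeasurable _))
    (Eventually.of_forall fun x => h _ (norm_nonneg _))

lemma energyDensity_eq (s : ℝ) (W : ℝ → ℝ) (ψ : Hs s) : energyDensity s W ψ = fun x =>
    1 / 2 * ‖fracD s ψ x‖ ^ 2 + E₀ W * ‖toL2 s ψ x‖ ^ 2 + N W ‖toL2 s ψ x‖ := by
  ext x
  simp only [energyDensity, N]
  ring

lemma integrable_quadratic (s : ℝ) (W : ℝ → ℝ) (ψ : Hs s) : Integrable fun x =>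
    1 / 2 * ‖fracD s ψ x‖ ^ 2 + E₀ W * ‖toL2 s ψ x‖ ^ 2 :=
  ((integrable_norm_sq _).const_mul _).add ((integrable_norm_sq _).const_mul _)

lemma integrable_energyDensity {s : ℝ} {W : ℝ → ℝ} {ψ : Hs s}
    (h : Integrable fun x => N W ‖toL2 s ψ x‖) : Integrable (energyDensity s W ψ) := by
  rw [energyDensity_eq]
  exact (integrable_quadratic s W ψ).add h

lemma energy_eq {s : ℝ} {W : ℝ → ℝ} {ψ : Hs s} (h : Integrable fun x => N W ‖toL2 s ψ x‖) :
    energy s W ψ = 1 / 2 * ‖fracD s ψ‖ ^ 2 + E₀ W * ‖toL2 s ψ‖ ^ 2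
      + ∫ x, N W ‖toL2 s ψ x‖ := by
  rw [energy, energyDensity_eq, integral_add (integrable_quadratic s W ψ) h,
    integral_add ((integrable_norm_sq _).const_mul _) ((integrable_norm_sq _).const_mul _),
    integral_const_mul, integral_const_mul, ← norm_sq_eq_integral, ← norm_sq_eq_integral]

lemma charge_eq (s : ℝ) (ψ : Hs s) : charge s ψ = ‖toL2 s ψ‖ ^ 2 := (norm_sq_eq_integral _).symm

lemma norm_toL2_pos {s : ℝ} {ψ : Hs s} (h : ψ ≠ 0) : 0 < ‖toL2 s ψ‖ :=
  norm_pos_iff.2 fun h0 => h (toL2_injective s (by rw [h0, map_zero]))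

lemma hylenicRatio_eq {s : ℝ} {W : ℝ → ℝ} {ψ : Hs s} (hψ : ψ ≠ 0)
    (h : Integrable fun x => N W ‖toL2 s ψ x‖) :
    hylenicRatio s W ψ = E₀ W
      + (1 / 2 * ‖fracD s ψ‖ ^ 2 + ∫ x, N W ‖toL2 s ψ x‖) / ‖toL2 s ψ‖ ^ 2 := by
  have := norm_toL2_pos hψ
  rw [hylenicRatio, energy_eq h, charge_eq, abs_of_nonneg (by positivity)]
  field_simp
  ring

/-! ### The lower bound for vanishing sequences -/

/-- In δ‖u_n‖² = δ‖u_n‖²_{L²} + δ‖D^s u_n‖² the last term is absorbed by the kinetic energy as δ ≤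
½; dividing by the charge leaves a loss of δ only. -/
lemma E₀_le_liminf {s : ℝ} (hs : 1 / 2 ≤ s) {W : ℝ → ℝ} (hW : ContDiffOn ℝ 2 W (Set.Ici 0))
    {q₁ q₂ c : ℝ} (hq₁ : 2 < q₁) (hq : q₁ ≤ q₂) (hc : 0 ≤ c)
    (h : ∀ r, 0 ≤ r → |N W r| ≤ c * (r ^ q₁ + r ^ q₂)) {u : ℕ → Hs s} (hu0 : ∀ n, u n ≠ 0)
    (hu : IsVanishing s u) :
    (E₀ W : EReal) ≤ liminf (fun n => (hylenicRatio s W (u n) : EReal)) atTop := by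
  refine EReal.ge_of_forall_gt_iff_ge.1 fun e he => ?_
  have he : e < E₀ W := EReal.coe_lt_coe_iff.1 he
  set δ := min (1 / 2) (E₀ W - e)
  have hδ : 0 < δ := lt_min (by norm_num) (by linarith)
  have hNi := integrable_N_norm hs hW hq₁ (hq₁.trans_le hq) h
  refine le_liminf_of_le (by isBoundedDefault) ?_
  filter_upwards [hu.eventually_integral_le hs (G := fun r => -N W r) (q := q₂) (by linarith)
    (fun δ hδ => exists_quadratic_or_power_bound hq₁ hq hc
      (fun r hr => (neg_le_abs _).trans (h r hr)) hδ) (fun n => (hNi (u n)).neg) hδ] with n hn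
  refine EReal.coe_le_coe_iff.2 ?_
  have hpos := norm_toL2_pos (hu0 n)
  rw [hylenicRatio_eq (hu0 n) (hNi _)]
  rw [integral_neg, norm_sq_eq] at hn
  have h1 : -δ ≤ (1 / 2 * ‖fracD s (u n)‖ ^ 2 + ∫ x, N W ‖toL2 s (u n) x‖)
      / ‖toL2 s (u n)‖ ^ 2 := by
    rw [le_div_iff₀ (by positivity)]
    have : δ * ‖fracD s (u n)‖ ^ 2 ≤ 1 / 2 * ‖fracD s (u n)‖ ^ 2 := by
      gcongr
      exact min_le_left _ _
    linarith
  have h2 : δ ≤ E₀ W - e := min_le_right _ _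
  linarith

/-! ### Schwartz functions in `H^s` and their dilations -/

/-- The symbol need not be smooth at 0, so the product need not be Schwartz; instead the square of
the symbol is dominated by 1 plus an integer power. -/
lemma memLp_symbol_mul_schwartz {s : ℝ} (hs : 0 ≤ s) (f : SchwartzMap ℝ ℂ) :
    MemLp (fun ξ => (symbol s ξ : ℂ) * f ξ) 2 volume := by
  have hm : AEStronglyMeasurable (fun ξ => (symbol s ξ : ℂ) * f ξ) volume :=
    (Complex.measurable_ofReal.comp (measurable_symbol s)).aestronglyMeasurable.mul
      f.continuous.aestronglyMeasurable
  rw [memLp_two_iff_integrable_sq_norm hm]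
  obtain ⟨k, hk⟩ := exists_nat_ge (2 * s)
  obtain ⟨C, hC⟩ : ∃ C, ∀ ξ, ‖f ξ‖ ≤ C :=
    ⟨_, fun ξ => SchwartzMap.norm_le_seminorm ℝ f ξ⟩
  have hi := ((f.integrable_pow_mul volume 0).add
    ((f.integrable_pow_mul volume k).const_mul ((2 * Real.pi) ^ k))).const_mul C
  refine hi.mono' (hm.norm.pow 2) (Eventually.of_forall fun ξ => ?_)
  have hC0 : 0 ≤ C := (norm_nonneg _).trans (hC ξ)
  have h1 : symbol s ξ ^ 2 ≤ 1 + (2 * Real.pi) ^ k * |ξ| ^ k := by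
    rw [symbol_sq, ← mul_pow, ← abs_of_pos Real.two_pi_pos, ← abs_mul, abs_of_pos Real.two_pi_pos]
    set y := |2 * Real.pi * ξ|
    have hy : 0 ≤ y := abs_nonneg _
    rcases le_or_gt y 1 with h | h
    · have := Real.rpow_le_one hy h (by linarith : 0 ≤ 2 * s)
      have : 0 ≤ y ^ k := by positivity
      linarith
    · have := Real.rpow_le_rpow_of_exponent_le h.le hk
      rw [Real.rpow_natCast] at this
      linarith
  rw [Real.norm_of_nonneg (by positivity), norm_mul, mul_pow, Complex.norm_real,
    Real.norm_of_nonneg (symbol_nonneg s ξ)]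
  simp only [Pi.add_apply, pow_zero, one_mul, Real.norm_eq_abs]
  calc symbol s ξ ^ 2 * ‖f ξ‖ ^ 2
      ≤ (1 + (2 * Real.pi) ^ k * |ξ| ^ k) * (C * ‖f ξ‖) := by
        rw [sq ‖f ξ‖]
        gcongr
        exact hC ξ
    _ = _ := by ring

/-- A Schwartz function as an element of `H^s`. -/
noncomputable def ofSchwartz {s : ℝ} (hs : 0 ≤ s) (f : SchwartzMap ℝ ℂ) : Hs s :=
  ⟨f.toLp 2 volume, by
    refine (memLp_symbol_mul_schwartz hs (𝓕 f)).ae_eq ?_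
    have h : fourierL2 (f.toLp 2 volume) = (𝓕 f).toLp 2 volume := SchwartzMap.toLp_fourier_eq f
    rw [h]
    filter_upwards [(𝓕 f).coeFn_toLp 2 volume] with ξ hξ
    rw [hξ]⟩

lemma toL2_ofSchwartz {s : ℝ} (hs : 0 ≤ s) (f : SchwartzMap ℝ ℂ) :
    toL2 s (ofSchwartz hs f) = f.toLp 2 volume := rfl

lemma norm_fracD_ofSchwartz_sq {s : ℝ} (hs : 0 ≤ s) (f : SchwartzMap ℝ ℂ) :
    ‖fracD s (ofSchwartz hs f)‖ ^ 2 = ∫ ξ, symbol s ξ ^ 2 * ‖𝓕 (f : ℝ → ℂ) ξ‖ ^ 2 := by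
  rw [norm_fracD_sq, toL2_ofSchwartz]
  have h : fourierL2 (f.toLp 2 volume) = (𝓕 f).toLp 2 volume := SchwartzMap.toLp_fourier_eq f
  rw [h]
  refine integral_congr_ae ?_
  filter_upwards [(𝓕 f).coeFn_toLp 2 volume] with ξ hξ
  rw [hξ, SchwartzMap.fourier_coe]

lemma integral_comp_norm_ofSchwartz {s : ℝ} (hs : 0 ≤ s) (f : SchwartzMap ℝ ℂ) (G : ℝ → ℝ) :
    ∫ x, G ‖toL2 s (ofSchwartz hs f) x‖ = ∫ x, G ‖f x‖ := by
  refine integral_congr_ae ?_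
  rw [toL2_ofSchwartz]
  filter_upwards [f.coeFn_toLp 2 volume] with x hx
  rw [hx]

/-- The dilation `f(· / L)` of a Schwartz function. -/
noncomputable def dilate {L : ℝ} (hL : L ≠ 0) (f : SchwartzMap ℝ ℂ) : SchwartzMap ℝ ℂ :=
  SchwartzMap.compCLMOfContinuousLinearEquiv ℂ
    (LinearEquiv.smulOfNeZero ℝ ℝ L⁻¹ (inv_ne_zero hL)).toContinuousLinearEquiv f

lemma dilate_apply {L : ℝ} (hL : L ≠ 0) (f : SchwartzMap ℝ ℂ) (x : ℝ) :
    dilate hL f x = f (L⁻¹ * x) := rfl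

lemma fourier_dilate {L : ℝ} (hL : 0 < L) (f : SchwartzMap ℝ ℂ) (ξ : ℝ) :
    𝓕 (dilate hL.ne' f : ℝ → ℂ) ξ = L * 𝓕 (f : ℝ → ℂ) (L * ξ) := by
  rw [Real.fourier_eq, Real.fourier_eq]
  have h := Measure.integral_comp_mul_left
    (fun y : ℝ => Real.fourierChar (-inner ℝ y (L * ξ)) • f y) L⁻¹
  rw [inv_inv, abs_of_pos hL, Complex.real_smul] at h
  rw [← h]
  refine integral_congr_ae (Eventually.of_forall fun x => ?_)
  simp only [dilate_apply, RCLike.inner_apply, conj_trivial]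
  congr 3
  field_simp

lemma integral_norm_dilate {L : ℝ} (hL : 0 < L) (f : SchwartzMap ℝ ℂ) (G : ℝ → ℝ) :
    ∫ x, G ‖dilate hL.ne' f x‖ = L * ∫ x, G ‖f x‖ := by
  have h := Measure.integral_comp_mul_left (fun y : ℝ => G ‖f y‖) L⁻¹
  rw [inv_inv, abs_of_pos hL, smul_eq_mul] at h
  exact h

/-- The transform of the dilate is L·f̂(Lξ): the amplitude gives L², the symbol L^(-2s), the change
of variables L⁻¹. One L is kept outside to match the scaling of ∫ N. -/
lemma norm_fracD_dilate_sq {s : ℝ} (hs : 0 ≤ s) {L : ℝ} (hL : 0 < L) (f : SchwartzMap ℝ ℂ) :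
    ‖fracD s (ofSchwartz hs (dilate hL.ne' f))‖ ^ 2
      = L * (L ^ (-(2 * s)) * ‖fracD s (ofSchwartz hs f)‖ ^ 2) := by
  rw [norm_fracD_ofSchwartz_sq, norm_fracD_ofSchwartz_sq]
  have h := Measure.integral_comp_mul_left
    (fun ξ : ℝ => symbol s ξ ^ 2 * ‖𝓕 (f : ℝ → ℂ) ξ‖ ^ 2) L
  rw [abs_of_pos (inv_pos.2 hL), smul_eq_mul] at h
  have h2 : ∀ ξ, symbol s ξ ^ 2 * ‖𝓕 (dilate hL.ne' f : ℝ → ℂ) ξ‖ ^ 2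
      = L ^ (-(2 * s)) * L ^ 2
        * (symbol s (L * ξ) ^ 2 * ‖𝓕 (f : ℝ → ℂ) (L * ξ)‖ ^ 2) := fun ξ => by
    rw [fourier_dilate hL, norm_mul, Complex.norm_real, Real.norm_of_nonneg hL.le, symbol_sq,
      symbol_sq, show 2 * Real.pi * (L * ξ) = L * (2 * Real.pi * ξ) by ring, abs_mul L,
      abs_of_pos hL, Real.mul_rpow hL.le (abs_nonneg _), Real.rpow_neg hL.le]
    have : 0 < L ^ (2 * s) := by positivity
    field_simp
  simp_rw [h2]
  rw [integral_const_mul, h]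
  field_simp

/-! ### A plateau function with negative nonlinear energy -/

/-- A smooth plateau of height r₀ gains in proportion to its width 2R, while its two transition
layers have fixed total length 2 and cost at most S per unit length. -/
lemma exists_schwartz_integral_neg {G : ℝ → ℝ} (hG : ContinuousOn G (Set.Ici 0)) (hG0 : G 0 = 0)
    {r₀ : ℝ} (hr₀ : 0 < r₀) (hneg : G r₀ < 0) :
    ∃ f : SchwartzMap ℝ ℂ, ∫ x, G ‖f x‖ < 0 := by
  obtain ⟨S, hS⟩ := (isCompact_Icc (a := (0 : ℝ)) (b := r₀)).exists_bound_of_continuousOn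
    (hG.mono Set.Icc_subset_Ici_self)
  have hS0 : 0 ≤ S := (norm_nonneg _).trans (hS r₀ ⟨hr₀.le, le_rfl⟩)
  -- With this width the bound on the integral is 2R·G(r₀) + 2S = -2.
  set R := (S + 1) / (-G r₀) with hR
  have hR0 : 0 < R := div_pos (by linarith) (by linarith)
  let b : ContDiffBump (0 : ℝ) := ⟨R, R + 1, hR0, by linarith⟩
  have hc₁ : HasCompactSupport (fun x : ℝ => ((r₀ * b x : ℝ) : ℂ)) :=
    b.hasCompactSupport.mono (fun x hx hb => hx (by simp [hb]))
  have hc₂ : ContDiff ℝ (⊤ : ℕ∞) (fun x : ℝ => ((r₀ * b x : ℝ) : ℂ)) :=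
    Complex.ofRealCLM.contDiff.comp (contDiff_const.mul b.contDiff)
  refine ⟨hc₁.toSchwartzMap hc₂, ?_⟩
  have hf : ∀ x, ‖hc₁.toSchwartzMap hc₂ x‖ = r₀ * b x := fun x => by
    change ‖((r₀ * b x : ℝ) : ℂ)‖ = _
    rw [Complex.norm_real, Real.norm_of_nonneg (mul_nonneg hr₀.le b.nonneg)]
  simp_rw [hf]
  -- A step majorant: G(r₀) on the plateau, S on the transition layers, 0 outside.
  set g : ℝ → ℝ := fun x => (Set.Icc (-(R + 1)) (R + 1)).indicator (fun _ => S) x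
    + (Set.Icc (-R) R).indicator (fun _ => G r₀ - S) x with hg
  have i1 : Integrable ((Set.Icc (-(R + 1)) (R + 1)).indicator (fun _ => S)) :=
    (integrable_indicator_iff measurableSet_Icc).2 (by simp)
  have i2 : Integrable ((Set.Icc (-R) R).indicator (fun _ => G r₀ - S)) :=
    (integrable_indicator_iff measurableSet_Icc).2 (by simp)
  have hmem : ∀ x, r₀ * b x ∈ Set.Icc 0 r₀ := fun x =>
    ⟨mul_nonneg hr₀.le b.nonneg, mul_le_of_le_one_right hr₀.le b.le_one⟩
  have hout : ∀ x, x ∉ Set.Icc (-(R + 1)) (R + 1) → G (r₀ * b x) = 0 := fun x hx => by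
    have : b x = 0 := b.zero_of_le_dist (by
      rw [Set.mem_Icc, ← abs_le, not_le] at hx
      simpa using hx.le)
    rw [this, mul_zero, hG0]
  have hle : ∀ x, G (r₀ * b x) ≤ g x := fun x => by
    have habs : |G (r₀ * b x)| ≤ S := hS _ (hmem x)
    by_cases h1 : x ∈ Set.Icc (-R) R
    · have h2 : x ∈ Set.Icc (-(R + 1)) (R + 1) := ⟨by linarith [h1.1], by linarith [h1.2]⟩
      have : b x = 1 := b.one_of_mem_closedBall (by
        rw [Metric.mem_closedBall, Real.dist_eq, sub_zero]
        exact abs_le.2 h1)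
      simp only [hg, Set.indicator_of_mem h1, Set.indicator_of_mem h2, this]
      simp
    · by_cases h2 : x ∈ Set.Icc (-(R + 1)) (R + 1)
      · simp only [hg, Set.indicator_of_notMem h1, Set.indicator_of_mem h2]
        linarith [le_abs_self (G (r₀ * b x))]
      · simp only [hg, Set.indicator_of_notMem h1, Set.indicator_of_notMem h2, hout x h2, add_zero,
          le_refl]
  have hcont : Continuous fun x => G (r₀ * b x) :=
    hG.comp_continuous (continuous_const.mul b.continuous) fun x => (hmem x).1
  have hint : Integrable fun x => G (r₀ * b x) := by
    refine hcont.integrable_of_hasCompactSupport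
      (HasCompactSupport.intro (isCompact_Icc (a := -(R + 1)) (b := R + 1)) hout)
  refine (integral_mono hint (i1.add i2) hle).trans_lt ?_
  simp only [Pi.add_apply]
  rw [integral_add i1 i2, integral_indicator measurableSet_Icc, integral_indicator measurableSet_Icc,
    setIntegral_const, setIntegral_const, Real.volume_real_Icc_of_le (by linarith),
    Real.volume_real_Icc_of_le (by linarith)]
  have : R * G r₀ = -(S + 1) := by
    rw [hR]
    have : G r₀ ≠ 0 := hneg.ne
    field_simp
  simp only [smul_eq_mul]
  nlinarith

/-- If the nonlinear part of the energy is negative somewhere, then wide plateaus have a hylenic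
ratio below `E₀`. -/
lemma exists_hylenicRatio_lt {s : ℝ} (hs : 0 < s) {W : ℝ → ℝ}
    (hW : ContDiffOn ℝ 2 W (Set.Ici 0)) (hW0 : W 0 = 0)
    (hN : ∃ r₀ : ℝ, 0 < r₀ ∧ N W r₀ < 0)
    (hi : ∀ ψ : Hs s, Integrable fun x => N W ‖toL2 s ψ x‖) :
    ∃ ψ : Hs s, ψ ≠ 0 ∧ hylenicRatio s W ψ < E₀ W := by
  obtain ⟨r₀, hr₀, hneg⟩ := hN
  have hN0 : N W 0 = 0 := by simp [N, hW0]
  obtain ⟨f, hf⟩ := exists_schwartz_integral_neg (differentiableOn_N hW).continuousOn hN0 hr₀ hneg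
  set I := ∫ x, N W ‖f x‖
  set D := ‖fracD s (ofSchwartz hs.le f)‖ ^ 2
  -- After division by L, the kinetic term of the dilate tends to 0 while the nonlinear term stays
  -- at I < 0.
  have hlim : Tendsto (fun L : ℝ => 1 / 2 * (L ^ (-(2 * s)) * D)) atTop (𝓝 (1 / 2 * (0 * D))) :=
    ((tendsto_rpow_neg_atTop (by linarith)).mul_const D).const_mul _
  have hev := hlim.eventually_lt_const (u := -I) (by linarith)
  obtain ⟨L, hL1, hL⟩ := (hev.and (eventually_gt_atTop 0)).exists
  set ψ := ofSchwartz hs.le (dilate hL.ne' f)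
  have hD : ‖fracD s ψ‖ ^ 2 = L * (L ^ (-(2 * s)) * D) := norm_fracD_dilate_sq hs.le hL f
  have hI : ∫ x, N W ‖toL2 s ψ x‖ = L * I :=
    (integral_comp_norm_ofSchwartz hs.le _ _).trans (integral_norm_dilate hL f _)
  have hψ : ψ ≠ 0 := fun h0 => by
    have h1 : ∫ x, N W ‖toL2 s ψ x‖ = 0 := by
      rw [h0, map_zero]
      refine integral_eq_zero_of_ae ?_
      filter_upwards [Lp.coeFn_zero ℂ 2 (volume : Measure ℝ)] with x hx
      rw [hx]
      simp [hN0]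
    rw [hI] at h1
    exact (mul_neg_of_pos_of_neg hL hf).ne h1
  refine ⟨ψ, hψ, ?_⟩
  rw [hylenicRatio_eq hψ (hi ψ), hD, hI]
  have hpos := norm_toL2_pos hψ
  have : (1 / 2 * (L * (L ^ (-(2 * s)) * D)) + L * I) / ‖toL2 s ψ‖ ^ 2 < 0 := by
    refine div_neg_of_neg_of_pos ?_ (by positivity)
    nlinarith
  linarith

end Hylomorphy

/-! ### The hylomorphy condition -/

theorem mainTheorem9 (s : ℝ) (hs : 1 / 2 ≤ s) (W : ℝ → ℝ)
    (hW : ContDiffOn ℝ 2 W (Set.Ici 0))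
    (hW0 : W 0 = 0) (hW0' : derivWithin W (Set.Ici 0) 0 = 0)
    (hE₀ : 0 < Hylomorphy.E₀ W)
    (hN : ∃ r₀ : ℝ, 0 < r₀ ∧ Hylomorphy.N W r₀ < 0)
    (hN' : ∃ q₁ q₂ c₁ : ℝ, 2 < q₁ ∧ q₁ ≤ q₂ ∧ ∀ r : ℝ, 0 ≤ r →
      |derivWithin (Hylomorphy.N W) (Set.Ici 0) r| ≤ c₁ * (r ^ (q₁ - 1) + r ^ (q₂ - 1)))
    (hNp : ∃ p c : ℝ, 2 < p ∧ p < 4 * s + 2 ∧ 0 ≤ c ∧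
      ∀ᶠ r : ℝ in atTop, -c * r ^ p ≤ Hylomorphy.N W r) :
    (∀ ψ : Hylomorphy.Hs s, Integrable (Hylomorphy.energyDensity s W ψ)) ∧
      (⨅ ψ : {ψ : Hylomorphy.Hs s // ψ ≠ 0}, (Hylomorphy.hylenicRatio s W ψ.1 : EReal))
        < Hylomorphy.Λ₀ s W := by
  obtain ⟨q₁, q₂, c, hq₁, hq, hd⟩ := hN'
  have hbound : ∀ r, 0 ≤ r → |Hylomorphy.N W r| ≤ c * (r ^ q₁ + r ^ q₂) := fun r hr =>
    Hylomorphy.abs_N_le hW hW0 hq₁ (hq₁.trans_le hq) hd hr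
  have hc : 0 ≤ c := by
    have := (abs_nonneg _).trans (hbound 1 zero_le_one)
    simp only [Real.one_rpow] at this
    linarith
  have hi := Hylomorphy.integrable_N_norm hs hW hq₁ (hq₁.trans_le hq) hbound
  refine ⟨fun ψ => Hylomorphy.integrable_energyDensity (hi ψ), ?_⟩
  obtain ⟨ψ, hψ, hlt⟩ := Hylomorphy.exists_hylenicRatio_lt (by linarith) hW hW0 hN hi
  have hle : (Hylomorphy.E₀ W : EReal) ≤ Hylomorphy.Λ₀ s W := by
    unfold Hylomorphy.Λ₀
    refine le_sInf ?_
    rintro l ⟨u, hu0, hu, hl⟩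
    rw [hl]
    exact Hylomorphy.E₀_le_liminf hs hW hq₁ hq hc hbound hu0 hu
  have hlt' : (Hylomorphy.hylenicRatio s W ψ : EReal) < Hylomorphy.E₀ W :=
    EReal.coe_lt_coe_iff.2 hlt
  exact (iInf_le (fun ψ : {ψ : Hylomorphy.Hs s // ψ ≠ 0} =>
    (Hylomorphy.hylenicRatio s W ψ.1 : EReal)) ⟨ψ, hψ⟩).trans_lt (hlt'.trans_le hle)
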